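/- Let $n\ge 2$, $\Gamma=\mathrm{SL}_n(\mathbb Z)$ and $\mathcal H_n=\mathrm{PGL}_n(\mathbb R)/\mathrm{PO}(n)$. For a prime $p$ and $\mathbf a=(a_1,\dots,a_n)\in\mathbb Z^n$ let $T_{\mathbf a}(p)$ be the Hecke operator $F\mapsto\sum_k F(M_k\,\cdot)$ on the space of functions $F:\Gamma\backslash\mathcal H_n\to\mathbb C$, where $\Gamma\,\mathrm{diag}(p^{a_1},\dots,p^{a_n})\,\Gamma=\bigcup_k\Gamma M_k$ is the (finite, disjoint) decomposition into cosets. Put $T_{[j]}(p)=T_{(j,0,\dots,0)}(p)$ and $T'_{[j]}(p)=T_{(j,\dots,j,0)}(p)$. There is a constant $C=C(n)$ depending only on $n$ such that for every prime $p$ and every $1\le j\le n$ there are real numbers $c_{ij}$ $(0\le i\le j)$, which may depend on $p$, with $|c_{ij}|\le C$ and $$T_{[j]}(p)\,T'_{[j]}(p)=\sum_{i=0}^{j}c_{ij}\,p^{(n-1)i}\,T_{(2j-i,\,j,\dots,j,\,i)}(p)=\sum_{i=0}^{j}c_{ij}\,p^{(n-1)i}\,T_{(2j-2i,\,j-i,\dots,j-i,\,0)}(p).$$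 -/

import Mathlib

open scoped MatrixGroups

noncomputable section

namespace GLHecke

/-! ### The locally symmetric space `Γ \ 𝓗_n` -/

/-- `Γ = SL_n(ℤ)`, viewed as a subgroup of `GL_n(ℝ)`. -/
def Gam (n : ℕ) : Subgroup (GL (Fin n) ℝ) :=
  (Matrix.SpecialLinearGroup.mapGL ℝ :
    Matrix.SpecialLinearGroup (Fin n) ℤ →* GL (Fin n) ℝ).range

/-- `PO(n)`, the image of the orthogonal group `O(n)` in `PGL_n(ℝ)`. -/
def PO (n : ℕ) : Subgroup (Matrix.ProjGenLinGroup (Fin n) ℝ) :=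
  ((Matrix.ProjGenLinGroup.mk : GL (Fin n) ℝ →* Matrix.ProjGenLinGroup (Fin n) ℝ).comp
    (Unitary.toUnits : Matrix.orthogonalGroup (Fin n) ℝ →* GL (Fin n) ℝ)).range

/-- The generalized upper half plane `𝓗_n = PGL_n(ℝ) / PO(n)`. -/
def UpperHalf (n : ℕ) : Type := Matrix.ProjGenLinGroup (Fin n) ℝ ⧸ PO n

instance (n : ℕ) : MulAction (Matrix.ProjGenLinGroup (Fin n) ℝ) (UpperHalf n) :=
  inferInstanceAs (MulAction (Matrix.ProjGenLinGroup (Fin n) ℝ)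
    (Matrix.ProjGenLinGroup (Fin n) ℝ ⧸ PO n))

/-- `GL_n(ℝ)` acts on `𝓗_n` by left multiplication, through `PGL_n(ℝ)`. -/
instance (n : ℕ) : MulAction (GL (Fin n) ℝ) (UpperHalf n) :=
  MulAction.compHom (UpperHalf n) (Matrix.ProjGenLinGroup.mk (n := Fin n) (R := ℝ))

/-- The quotient `Γ \ 𝓗_n`. -/
def LocSym (n : ℕ) : Type := MulAction.orbitRel.Quotient (Gam n) (UpperHalf n)

/-- The point `Γ x` of `Γ \ 𝓗_n`. -/
def LocSym.mk {n : ℕ} (x : UpperHalf n) : LocSym n :=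
  Quotient.mk (MulAction.orbitRel (Gam n) (UpperHalf n)) x

theorem LocSym.mk_smul {n : ℕ} {g : GL (Fin n) ℝ} (hg : g ∈ Gam n) (x : UpperHalf n) :
    LocSym.mk (g • x) = LocSym.mk x :=
  Quotient.sound (s := MulAction.orbitRel (Gam n) (UpperHalf n)) ⟨⟨g, hg⟩, rfl⟩

/-! ### Hecke operators -/

/-- The set `Γ \ GL_n(ℝ)` of cosets `Γ M`. -/
abbrev Cosets (n : ℕ) : Type := Quotient (QuotientGroup.rightRel (Gam n))

/-- The set of those cosets `Γ M` that are contained in the double coset `Γ A Γ`. -/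
def cosetsIn {n : ℕ} (A : GL (Fin n) ℝ) : Set (Cosets n) :=
  Quotient.mk (QuotientGroup.rightRel (Gam n)) '' DoubleCoset.doubleCoset A (Gam n) (Gam n)

/-- The point `Γ M x` of `Γ \ 𝓗_n`, for a coset `Γ M` and a point `x` of `𝓗_n`. -/
def cosetPoint {n : ℕ} (c : Cosets n) (x : UpperHalf n) : LocSym n :=
  Quotient.lift (fun M : GL (Fin n) ℝ => LocSym.mk (M • x)) (by
    intro M M' h
    have h' : M' * M⁻¹ ∈ Gam n := QuotientGroup.rightRel_apply.mp h
    have := LocSym.mk_smul h' (M • x)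
    rw [smul_smul, inv_mul_cancel_right] at this
    exact this.symm) c

/-- Right multiplication by an element of `Γ` permutes the cosets in `Γ A Γ`. -/
def cosetsInMul {n : ℕ} (A : GL (Fin n) ℝ) {g : GL (Fin n) ℝ} (hg : g ∈ Gam n) :
    cosetsIn A → cosetsIn A := fun c =>
  ⟨Quotient.map' (s₁ := QuotientGroup.rightRel (Gam n)) (s₂ := QuotientGroup.rightRel (Gam n))
      (fun M => M * g) (by
        intro M M' h
        have h' : M' * M⁻¹ ∈ Gam n := QuotientGroup.rightRel_apply.mp h
        refine QuotientGroup.rightRel_apply.mpr ?_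
        simpa [mul_assoc] using h') c.1, by
    obtain ⟨c, M, hM, rfl⟩ := c
    refine ⟨M * g, ?_, rfl⟩
    obtain ⟨a, ha, b, hb, rfl⟩ := DoubleCoset.mem_doubleCoset.mp hM
    exact DoubleCoset.mem_doubleCoset.mpr
      ⟨a, ha, b * g, (Gam n).mul_mem hb hg, by simp [mul_assoc]⟩⟩

theorem cosetsInMul_bijective {n : ℕ} (A : GL (Fin n) ℝ) {g : GL (Fin n) ℝ} (hg : g ∈ Gam n) :
    Function.Bijective (cosetsInMul A hg) := by
  have key : ∀ {g h : GL (Fin n) ℝ} (hg : g ∈ Gam n) (hh : h ∈ Gam n), g * h = 1 →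
      ∀ c, cosetsInMul A hh (cosetsInMul A hg c) = c := by
    rintro g h hg hh e ⟨c, M, hM, rfl⟩
    apply Subtype.ext
    change Quotient.mk (QuotientGroup.rightRel (Gam n)) (M * g * h) = _
    rw [mul_assoc, e, mul_one]
  have hi := (Gam n).inv_mem hg
  exact Function.bijective_iff_has_inverse.mpr
    ⟨cosetsInMul A hi, key hg hi (mul_inv_cancel g), key hi hg (inv_mul_cancel g)⟩

theorem cosetPoint_smul {n : ℕ} (A : GL (Fin n) ℝ) {g : GL (Fin n) ℝ} (hg : g ∈ Gam n)
    (c : cosetsIn A) (x : UpperHalf n) :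
    cosetPoint c.1 (g • x) = cosetPoint (cosetsInMul A hg c).1 x := by
  obtain ⟨c, M, hM, rfl⟩ := c
  change LocSym.mk (M • g • x) = LocSym.mk ((M * g) • x)
  rw [smul_smul]

/-- The function `Γ x ↦ ∑_j F(M_j x)` on `Γ \ 𝓗_n`, where `Γ A Γ = ⋃_j Γ M_j` (disjoint). -/
def heckeFun {n : ℕ} (A : GL (Fin n) ℝ) (F : LocSym n → ℂ) : LocSym n → ℂ :=
  Quotient.lift (s := MulAction.orbitRel (Gam n) (UpperHalf n))
    (fun x => ∑ᶠ c : cosetsIn A, F (cosetPoint c.1 x)) (by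
      rintro _ x ⟨⟨g, hg⟩, rfl⟩
      change ∑ᶠ c : cosetsIn A, F (cosetPoint c.1 (g • x)) = _
      simp_rw [cosetPoint_smul A hg]
      exact finsum_comp (g := fun c : cosetsIn A => F (cosetPoint c.1 x)) _
        (cosetsInMul_bijective A hg))

/-- The diagonal matrix `diag(p^{a_1}, …, p^{a_n})`. -/
def ppDiag {n : ℕ} (p : ℕ) [hp : Fact p.Prime] (a : Fin n → ℤ) : GL (Fin n) ℝ where
  val := Matrix.diagonal fun i => (p : ℝ) ^ a i
  inv := Matrix.diagonal fun i => (p : ℝ) ^ (-a i)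
  val_inv := by
    have : (p : ℝ) ≠ 0 := Nat.cast_ne_zero.mpr hp.out.ne_zero
    rw [Matrix.diagonal_mul_diagonal, ← Matrix.diagonal_one]
    congr 1
    funext i
    rw [← zpow_add₀ this, add_neg_cancel, zpow_zero]
  inv_val := by
    have : (p : ℝ) ≠ 0 := Nat.cast_ne_zero.mpr hp.out.ne_zero
    rw [Matrix.diagonal_mul_diagonal, ← Matrix.diagonal_one]
    congr 1
    funext i
    rw [← zpow_add₀ this, neg_add_cancel, zpow_zero]

/-- Conjugation by `diag(p^a)` maps a suitable principal congruence subgroup into `Γ`. -/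
theorem conj_mem {n : ℕ} (p : ℕ) [hp : Fact p.Prime] (a : Fin n → ℤ) (N : ℕ)
    (hN : ∀ i j, 0 ≤ a i - a j + N) (X : Matrix.SpecialLinearGroup (Fin n) ℤ)
    (hX : ∀ i j, ((p ^ N : ℕ) : ℤ) ∣ X.1 i j - (1 : Matrix (Fin n) (Fin n) ℤ) i j) :
    ppDiag p a * Matrix.SpecialLinearGroup.mapGL ℝ X * (ppDiag p a)⁻¹ ∈ Gam n := by
  have hp0 : (p : ℝ) ≠ 0 := Nat.cast_ne_zero.mpr hp.out.ne_zero
  choose Z hZ using hX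
  let Y : Matrix (Fin n) (Fin n) ℤ := fun i j =>
    (1 : Matrix (Fin n) (Fin n) ℤ) i j + (p : ℤ) ^ (a i - a j + N).toNat * Z i j
  have hY : Y.map (algebraMap ℤ ℝ) =
      (ppDiag p a * Matrix.SpecialLinearGroup.mapGL ℝ X * (ppDiag p a)⁻¹ : GL (Fin n) ℝ).1 := by
    ext i j
    have h1 : (ppDiag p a * Matrix.SpecialLinearGroup.mapGL ℝ X * (ppDiag p a)⁻¹ :
        GL (Fin n) ℝ).1 i j = (p : ℝ) ^ a i * (X.1 i j : ℝ) * (p : ℝ) ^ (-a j) := by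
      change (Matrix.diagonal (fun i => (p : ℝ) ^ a i) * X.1.map (algebraMap ℤ ℝ) *
        Matrix.diagonal (fun i => (p : ℝ) ^ (-a i))) i j = _
      rw [Matrix.mul_diagonal, Matrix.diagonal_mul]
      rfl
    have h2 : (X.1 i j : ℝ) = (1 : Matrix (Fin n) (Fin n) ℤ) i j + (p : ℝ) ^ N * Z i j := by
      have := congrArg (Int.cast : ℤ → ℝ) (hZ i j)
      push_cast at this
      linarith
    have h3 : (p : ℝ) ^ (a i - a j + N).toNat = (p : ℝ) ^ (a i) * (p : ℝ) ^ N *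
        (p : ℝ) ^ (-a j) := by
      rw [← zpow_natCast, Int.toNat_of_nonneg (hN i j), ← zpow_natCast, ← zpow_add₀ hp0,
        ← zpow_add₀ hp0]
      congr 1
      ring
    rw [h1, h2]
    change (((1 : Matrix (Fin n) (Fin n) ℤ) i j + (p : ℤ) ^ (a i - a j + N).toNat * Z i j : ℤ) : ℝ)
      = _
    push_cast
    rw [h3]
    by_cases h : i = j
    · subst h
      have : (p : ℝ) ^ a i * (p : ℝ) ^ (-a i) = 1 := by
        rw [← zpow_add₀ hp0]
        simp
      simp only [Matrix.one_apply_eq, Int.cast_one]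
      linear_combination (-1 : ℝ) * this
    · simp only [Matrix.one_apply_ne h, Int.cast_zero]
      ring
  have hdet : Y.det = 1 := by
    have h : ((Y.det : ℤ) : ℝ) = 1 := by
      have e : ((Y.det : ℤ) : ℝ) = (Y.map (algebraMap ℤ ℝ)).det :=
        RingHom.map_det (algebraMap ℤ ℝ) Y
      rw [e, hY, ← Matrix.GeneralLinearGroup.val_det_apply]
      simp
    exact_mod_cast h
  exact ⟨⟨Y, hdet⟩, Units.ext hY⟩

/-- The double coset `Γ diag(p^a) Γ` consists of finitely many cosets `Γ M`. -/
theorem finite_cosetsIn {n : ℕ} (p : ℕ) [hp : Fact p.Prime] (a : Fin n → ℤ) :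
    (cosetsIn (ppDiag p a)).Finite := by
  classical
  set N : ℕ := 2 * ∑ i, (a i).natAbs with hNdef
  have hb : ∀ i, |a i| ≤ ((∑ i, (a i).natAbs : ℕ) : ℤ) := fun i => by
    rw [Int.abs_eq_natAbs]
    exact_mod_cast Finset.single_le_sum (f := fun i => (a i).natAbs)
      (fun _ _ => Nat.zero_le _) (Finset.mem_univ i)
  have hN : ∀ i j, 0 ≤ a i - a j + N := fun i j => by
    have h1 := abs_le.mp (hb i)
    have h2 := abs_le.mp (hb j)
    rw [hNdef]
    push_cast at *
    linarith
  let f : Matrix.SpecialLinearGroup (Fin n) ℤ → Cosets n := fun d =>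
    Quotient.mk _ (ppDiag p a * Matrix.SpecialLinearGroup.mapGL ℝ d)
  let q : Matrix.SpecialLinearGroup (Fin n) ℤ →*
      Matrix.SpecialLinearGroup (Fin n) (ZMod (p ^ N)) :=
    Matrix.SpecialLinearGroup.map (Int.castRingHom (ZMod (p ^ N)))
  have : NeZero (p ^ N) := ⟨pow_ne_zero _ hp.out.ne_zero⟩
  have : Finite (Matrix.SpecialLinearGroup (Fin n) (ZMod (p ^ N))) :=
    Finite.of_injective (fun x => x.1) Subtype.val_injective
  have hf : Function.FactorsThrough f q := by
    intro d d' h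
    refine Quotient.sound (s := QuotientGroup.rightRel (Gam n)) ?_
    refine QuotientGroup.rightRel_apply.mpr ?_
    have hone : q (d' * d⁻¹) = 1 := by rw [map_mul, map_inv, h, mul_inv_cancel]
    have := conj_mem p a N hN (d' * d⁻¹) (fun i j => by
      have e := congrArg (fun M => M.1 i j) hone
      change (((d' * d⁻¹).1 i j : ℤ) : ZMod (p ^ N)) =
        (1 : Matrix (Fin n) (Fin n) (ZMod (p ^ N))) i j at e
      rw [← ZMod.intCast_zmod_eq_zero_iff_dvd]
      push_cast
      rw [e]
      by_cases hij : i = j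
      · subst hij
        simp
      · simp [Matrix.one_apply_ne hij])
    simpa [map_mul, mul_assoc] using this
  have : Nonempty (Cosets n) := ⟨f 1⟩
  obtain ⟨e, he⟩ := (Function.factorsThrough_iff f).mp hf
  refine (Set.finite_range e).subset ?_
  rintro _ ⟨M, hM, rfl⟩
  obtain ⟨x, hx, y, ⟨d, rfl⟩, rfl⟩ := DoubleCoset.mem_doubleCoset.mp hM
  refine ⟨q d, ?_⟩
  have h1 : e (q d) = f d := (congrFun he d).symm
  rw [h1]
  refine Quotient.sound (s := QuotientGroup.rightRel (Gam n)) ?_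
  refine QuotientGroup.rightRel_apply.mpr ?_
  simpa [mul_assoc] using hx

/-- The Hecke operator `T_a(p) : F ↦ ∑_j F(M_j ·)`, `Γ diag(p^{a_1}, …, p^{a_n}) Γ = ⋃_j Γ M_j`,
as a linear operator on the space of all functions `F : Γ \ 𝓗_n → ℂ`. The product of two
operators is their composition. -/
def T {n : ℕ} (p : ℕ) [Fact p.Prime] (a : Fin n → ℤ) : Module.End ℂ (LocSym n → ℂ) where
  toFun := heckeFun (ppDiag p a)
  map_add' F F' := by
    have := (finite_cosetsIn p a).to_subtype
    funext y
    induction y using Quotient.inductionOn with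
    | h x => exact finsum_add_distrib (Set.toFinite _) (Set.toFinite _)
  map_smul' z F := by
    funext y
    induction y using Quotient.inductionOn with
    | h x => exact (smul_finsum z (fun c : cosetsIn (ppDiag p a) => F (cosetPoint c.1 x))).symm

/-- The `n`-tuple `(a, b, …, b, c)` (for `n ≥ 2`). -/
def tuple (n : ℕ) (a b c : ℤ) : Fin n → ℤ := fun k =>
  if (k : ℕ) = 0 then a else if (k : ℕ) + 1 = n then c else b

/-- `T_{[j]}(p) = T_{(j, 0, …, 0)}(p)`. -/
def Tj (n p : ℕ) [Fact p.Prime] (j : ℕ) : Module.End ℂ (LocSym n → ℂ) :=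
  T p (tuple n j 0 0)

/-- `T'_{[j]}(p) = T_{(j, …, j, 0)}(p)`. -/
def Tj' (n p : ℕ) [Fact p.Prime] (j : ℕ) : Module.End ℂ (LocSym n → ℂ) :=
  T p (tuple n j j 0)

end GLHecke

end

/-!
A coset `Γ M` with `M` of positive determinant amounts to the lattice `L = ℤⁿ M` of row vectors.
Composing Hecke operators, `T_A T_B` is the sum of the operators of the double cosets `Γ E Γ`
contained in `Γ B Γ A Γ`, each taken with multiplicity the number of cosets `Γ M ⊆ Γ A Γ` such that
`E M⁻¹ ∈ Γ B Γ` (`heckeFun_heckeFun`). Here `A = diag(p^j, 1, …, 1)`, `B = diag(p^j, …, p^j, 1)`, and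
three facts remain.

* Which `E` occur. Up to `Γ` on both sides, `E = B Y A` with `Y ∈ SL_n(ℤ)`. Mod `p^j` only the last
  row of `B` survives, so `E` has rank one mod `p^j`, and likewise `p^(2j) E⁻¹`. Therefore at most one
  elementary divisor of `E` is below `p^j` and at most one is above it; as `det E = p^(nj)`, the
  elementary divisors are `p^(2j-i), p^j, …, p^j, p^i` for some `i ≤ j`
  (`exists_mem_dcoset_natTuple`). These double cosets are disjoint, since `p^i` is the gcd of the
  entries.

* How large the multiplicity is. The lattices `ℤⁿ M`, `M ∈ Γ A Γ`, are the lattices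
  `{v | v ⬝ u ≡ 0 mod p^j}` for primitive `u`, which matter only mod `p^j` and up to units. The
  condition at `E = diag(p^(2j-i), …, p^i)` forces the first coordinate of all these `v` to be
  divisible by `p^(j-i)`; so `u` can be scaled to have one coordinate `1` and the others divisible by
  `p^(j-i)`, which leaves at most `n (p^i)^(n-1)` possibilities (`ncard_factorSet_le`). Hence the
  constant `C = n` works.

* Subtracting `i` from all exponents multiplies `E` by a scalar matrix, which acts trivially on `𝓗_n`
  (`T_add_const`); this turns the first formula into the second.
-/

open scoped MatrixGroups

namespace GLHecke

/-! ### Composition of Hecke operators -/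

/-- The coset `Γ M`. -/
def coset {n : ℕ} (M : GL (Fin n) ℝ) : Cosets n :=
  Quotient.mk (QuotientGroup.rightRel (Gam n)) M

theorem coset_surjective {n : ℕ} (c : Cosets n) : ∃ M, coset M = c :=
  Quotient.exists_rep c

theorem coset_eq_coset_iff {n : ℕ} {M M' : GL (Fin n) ℝ} :
    coset M = coset M' ↔ M' * M⁻¹ ∈ Gam n :=
  Quotient.eq.trans QuotientGroup.rightRel_apply

/-- The double coset `Γ A Γ`. -/
abbrev dcoset {n : ℕ} (A : GL (Fin n) ℝ) : Set (GL (Fin n) ℝ) :=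
  DoubleCoset.doubleCoset A (Gam n) (Gam n)

theorem mul_mem_dcoset {n : ℕ} {A M g h : GL (Fin n) ℝ} (hg : g ∈ Gam n) (hM : M ∈ dcoset A)
    (hh : h ∈ Gam n) : g * M * h ∈ dcoset A := by
  obtain ⟨a, ha, b, hb, rfl⟩ := DoubleCoset.mem_doubleCoset.mp hM
  exact DoubleCoset.mem_doubleCoset.mpr
    ⟨g * a, (Gam n).mul_mem hg ha, b * h, (Gam n).mul_mem hb hh, by simp [mul_assoc]⟩

theorem left_mul_mem_dcoset {n : ℕ} {A M g : GL (Fin n) ℝ} (hg : g ∈ Gam n) (hM : M ∈ dcoset A) :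
    g * M ∈ dcoset A := by
  simpa using mul_mem_dcoset hg hM (Gam n).one_mem

theorem mul_right_mem_dcoset {n : ℕ} {A M h : GL (Fin n) ℝ} (hM : M ∈ dcoset A) (hh : h ∈ Gam n) :
    M * h ∈ dcoset A := by
  simpa using mul_mem_dcoset (Gam n).one_mem hM hh

theorem coset_mem_cosetsIn {n : ℕ} {A M : GL (Fin n) ℝ} :
    coset M ∈ cosetsIn A ↔ M ∈ dcoset A := by
  refine ⟨?_, fun h => ⟨M, h, rfl⟩⟩
  rintro ⟨N, hN, h⟩
  have := left_mul_mem_dcoset (coset_eq_coset_iff.mp h) hN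
  simpa using this

/-- The map `Γ M ↦ Γ M g` on cosets. -/
def cosetMul {n : ℕ} (g : GL (Fin n) ℝ) : Cosets n → Cosets n :=
  Quotient.map' (s₁ := QuotientGroup.rightRel (Gam n)) (s₂ := QuotientGroup.rightRel (Gam n))
    (fun M => M * g) (by
      intro M M' h
      have h' : M' * M⁻¹ ∈ Gam n := QuotientGroup.rightRel_apply.mp h
      refine QuotientGroup.rightRel_apply.mpr ?_
      simpa [mul_assoc] using h')

theorem cosetMul_coset {n : ℕ} (g M : GL (Fin n) ℝ) : cosetMul g (coset M) = coset (M * g) := rfl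

theorem cosetMul_cosetMul {n : ℕ} (g h : GL (Fin n) ℝ) (c : Cosets n) :
    cosetMul h (cosetMul g c) = cosetMul (g * h) c := by
  obtain ⟨M, rfl⟩ := coset_surjective c
  simp only [cosetMul_coset, mul_assoc]

theorem cosetMul_one {n : ℕ} (c : Cosets n) : cosetMul 1 c = c := by
  obtain ⟨M, rfl⟩ := coset_surjective c
  simp only [cosetMul_coset, mul_one]

theorem cosetMul_injective {n : ℕ} (g : GL (Fin n) ℝ) : Function.Injective (cosetMul (n := n) g) :=
  Function.LeftInverse.injective (g := cosetMul g⁻¹) fun c => by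
    rw [cosetMul_cosetMul, mul_inv_cancel, cosetMul_one]

theorem cosetPoint_coset {n : ℕ} (M : GL (Fin n) ℝ) (x : UpperHalf n) :
    cosetPoint (coset M) x = LocSym.mk (M • x) := rfl

theorem cosetPoint_smul_eq {n : ℕ} (c : Cosets n) (M : GL (Fin n) ℝ) (x : UpperHalf n) :
    cosetPoint c (M • x) = cosetPoint (cosetMul M c) x := by
  obtain ⟨N, rfl⟩ := coset_surjective c
  rw [cosetMul_coset, cosetPoint_coset, cosetPoint_coset, smul_smul]

theorem heckeFun_mk {n : ℕ} {A : GL (Fin n) ℝ} (hA : (cosetsIn A).Finite) (F : LocSym n → ℂ)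
    (x : UpperHalf n) :
    heckeFun A F (LocSym.mk x) = ∑ c ∈ hA.toFinset, F (cosetPoint c x) := by
  change ∑ᶠ c : cosetsIn A, F (cosetPoint c.1 x) = _
  rw [finsum_set_coe_eq_finsum_mem (cosetsIn A) (f := fun c => F (cosetPoint c x)),
    finsum_mem_eq_finite_toFinset_sum _ hA]

/-- The set of cosets `Γ M` contained in `Γ A Γ` such that `E M⁻¹` lies in `Γ B Γ`. Its cardinality
is the multiplicity of the coset `Γ E` in the product of the Hecke operators of `A` and `B`. -/
def factorSet {n : ℕ} (A B E : GL (Fin n) ℝ) : Set (Cosets n) :=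
  {c | ∃ M, coset M = c ∧ M ∈ dcoset A ∧ E * M⁻¹ ∈ dcoset B}

theorem coset_mem_factorSet {n : ℕ} {A B E M : GL (Fin n) ℝ} :
    coset M ∈ factorSet A B E ↔ M ∈ dcoset A ∧ E * M⁻¹ ∈ dcoset B := by
  refine ⟨?_, fun h => ⟨M, rfl, h⟩⟩
  rintro ⟨N, h, hN, hE⟩
  have h' := coset_eq_coset_iff.mp h
  constructor
  · simpa using left_mul_mem_dcoset h' hN
  · have := mul_right_mem_dcoset hE ((Gam n).inv_mem h')
    simpa [mul_assoc] using this

theorem factorSet_left_mul {n : ℕ} (A B E : GL (Fin n) ℝ) {g : GL (Fin n) ℝ} (hg : g ∈ Gam n) :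
    factorSet A B (g * E) = factorSet A B E := by
  ext c
  obtain ⟨M, rfl⟩ := coset_surjective c
  simp only [coset_mem_factorSet, mul_assoc]
  refine and_congr_right fun _ => ⟨fun h => ?_, left_mul_mem_dcoset hg⟩
  simpa using left_mul_mem_dcoset ((Gam n).inv_mem hg) h

theorem factorSet_mul_right {n : ℕ} (A B E : GL (Fin n) ℝ) {g : GL (Fin n) ℝ} (hg : g ∈ Gam n) :
    factorSet A B (E * g) = cosetMul g '' factorSet A B E := by
  ext c
  constructor
  · rintro ⟨M, rfl, hM, hE⟩
    refine ⟨coset (M * g⁻¹), coset_mem_factorSet.mpr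
      ⟨mul_right_mem_dcoset hM ((Gam n).inv_mem hg), ?_⟩, ?_⟩
    · simpa [mul_assoc] using hE
    · simp [cosetMul_coset]
  · rintro ⟨_, ⟨M, rfl, hM, hE⟩, rfl⟩
    rw [cosetMul_coset]
    refine coset_mem_factorSet.mpr ⟨mul_right_mem_dcoset hM hg, ?_⟩
    simpa [mul_assoc] using hE

theorem ncard_factorSet_eq {n : ℕ} (A B : GL (Fin n) ℝ) {E E' : GL (Fin n) ℝ}
    (h : E' ∈ dcoset E) : (factorSet A B E').ncard = (factorSet A B E).ncard := by
  obtain ⟨a, ha, b, hb, rfl⟩ := DoubleCoset.mem_doubleCoset.mp h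
  rw [factorSet_mul_right _ _ _ hb, Set.ncard_image_of_injective _ (cosetMul_injective b),
    factorSet_left_mul _ _ _ ha]

/-- If the products `N M` with `M ∈ Γ A Γ`, `N ∈ Γ B Γ` all lie in the disjoint double cosets
`Γ E_i Γ`, then the product of the Hecke operators of `A` and `B` is the combination of those of
the `E_i` with the multiplicities `#(factorSet A B E_i)`. -/
theorem heckeFun_heckeFun {n : ℕ} {A B : GL (Fin n) ℝ} (hA : (cosetsIn A).Finite)
    (hB : (cosetsIn B).Finite) (s : Finset ℕ) (E : ℕ → GL (Fin n) ℝ)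
    (hE : ∀ i, (cosetsIn (E i)).Finite)
    (hcover : ∀ M ∈ dcoset A, ∀ N ∈ dcoset B, ∃ i ∈ s, N * M ∈ dcoset (E i))
    (hdisj : ∀ i ∈ s, ∀ k ∈ s, i ≠ k → Disjoint (dcoset (E i)) (dcoset (E k)))
    (F : LocSym n → ℂ) (y : LocSym n) :
    heckeFun A (heckeFun B F) y =
      ∑ i ∈ s, ((factorSet A B (E i)).ncard : ℂ) * heckeFun (E i) F y := by
  classical
  obtain ⟨x, rfl⟩ : ∃ x, LocSym.mk x = y := Quotient.exists_rep y
  choose r hr using coset_surjective (n := n)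
  set f : Cosets n → ℂ := fun e => F (cosetPoint e x) with hf
  set U : Finset (Cosets n) := s.biUnion fun i => (hE i).toFinset with hU
  have inner : ∀ c ∈ hA.toFinset, heckeFun B F (cosetPoint c x) =
      ∑ e ∈ U, if cosetMul (r c)⁻¹ e ∈ cosetsIn B then f e else 0 := by
    intro c hc
    have hc' : r c ∈ dcoset A := by
      rw [← coset_mem_cosetsIn, hr]
      exact hA.mem_toFinset.mp hc
    rw [show cosetPoint c x = LocSym.mk (r c • x) by rw [← cosetPoint_coset, hr],
      heckeFun_mk hB, ← Finset.sum_filter]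
    refine Finset.sum_nbij' (cosetMul (r c)) (cosetMul (r c)⁻¹) ?_ ?_ ?_ ?_ ?_
    · intro d hd
      obtain ⟨N, rfl⟩ := coset_surjective d
      have hN := coset_mem_cosetsIn.mp (hB.mem_toFinset.mp hd)
      obtain ⟨i, hi, h⟩ := hcover _ hc' _ hN
      simp only [hU, Finset.mem_filter, Finset.mem_biUnion, Set.Finite.mem_toFinset]
      refine ⟨⟨i, hi, ?_⟩, ?_⟩
      · rwa [cosetMul_coset, coset_mem_cosetsIn]
      · rwa [cosetMul_cosetMul, mul_inv_cancel, cosetMul_one, coset_mem_cosetsIn]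
    · intro e he
      exact hB.mem_toFinset.mpr (Finset.mem_filter.mp he).2
    · intro d _
      rw [cosetMul_cosetMul, mul_inv_cancel, cosetMul_one]
    · intro d _
      rw [cosetMul_cosetMul, inv_mul_cancel, cosetMul_one]
    · intro d _
      rw [hf, cosetPoint_smul_eq]
  have count : ∀ M : GL (Fin n) ℝ,
      (hA.toFinset.filter fun c => cosetMul (r c)⁻¹ (coset M) ∈ cosetsIn B).card =
        (factorSet A B M).ncard := by
    intro M
    rw [← Set.ncard_coe_finset]
    congr 1
    ext c
    conv_rhs => rw [← hr c]
    rw [coset_mem_factorSet, ← coset_mem_cosetsIn, hr]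
    simp [cosetMul_coset, coset_mem_cosetsIn]
  rw [heckeFun_mk hA, Finset.sum_congr rfl inner, Finset.sum_comm, hU, Finset.sum_biUnion]
  · refine Finset.sum_congr rfl fun i _ => ?_
    rw [heckeFun_mk (hE i), Finset.mul_sum]
    refine Finset.sum_congr rfl fun e he => ?_
    obtain ⟨M, rfl⟩ := coset_surjective e
    have hM := coset_mem_cosetsIn.mp ((hE i).mem_toFinset.mp he)
    rw [← Finset.sum_filter, Finset.sum_const, count, ncard_factorSet_eq A B hM, nsmul_eq_mul]
  · intro i hi k hk hik
    refine Finset.disjoint_left.mpr fun e hei hek => ?_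
    obtain ⟨M, rfl⟩ := coset_surjective e
    exact Set.disjoint_left.mp (hdisj i hi k hk hik)
      (coset_mem_cosetsIn.mp ((hE i).mem_toFinset.mp hei))
      (coset_mem_cosetsIn.mp ((hE k).mem_toFinset.mp hek))

/-- A central matrix acts trivially on `𝓗_n`, so it does not change the Hecke operator. -/
theorem heckeFun_mul_central {n : ℕ} (A : GL (Fin n) ℝ) {z : GL (Fin n) ℝ}
    (hz : z ∈ Subgroup.center (GL (Fin n) ℝ)) (F : LocSym n → ℂ) :
    heckeFun (A * z) F = heckeFun A F := by
  funext y
  obtain ⟨x, rfl⟩ : ∃ x, LocSym.mk x = y := Quotient.exists_rep y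
  have hzx : z • x = x := by
    change (Matrix.ProjGenLinGroup.mk z : Matrix.ProjGenLinGroup (Fin n) ℝ) • x = x
    rw [Matrix.ProjGenLinGroup.mk_eq_one.mpr hz, one_smul]
  have hcomm := Subgroup.mem_center_iff.mp hz
  have himage : cosetsIn (A * z) = cosetMul z '' cosetsIn A := by
    ext c
    constructor
    · rintro ⟨_, hM, rfl⟩
      obtain ⟨a, ha, b, hb, rfl⟩ := DoubleCoset.mem_doubleCoset.mp hM
      refine ⟨coset (a * A * b), coset_mem_cosetsIn.mpr
        (DoubleCoset.mem_doubleCoset.mpr ⟨a, ha, b, hb, rfl⟩), ?_⟩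
      rw [cosetMul_coset]
      change coset _ = coset _
      congr 1
      simp only [mul_assoc, hcomm b]
    · rintro ⟨_, ⟨_, hM, rfl⟩, rfl⟩
      obtain ⟨a, ha, b, hb, rfl⟩ := DoubleCoset.mem_doubleCoset.mp hM
      refine ⟨a * (A * z) * b, DoubleCoset.mem_doubleCoset.mpr ⟨a, ha, b, hb, rfl⟩, ?_⟩
      change coset _ = cosetMul z (coset _)
      rw [cosetMul_coset]
      congr 1
      simp only [mul_assoc, hcomm b]
  change ∑ᶠ c : cosetsIn (A * z), F (cosetPoint c.1 x) = ∑ᶠ c : cosetsIn A, F (cosetPoint c.1 x)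
  rw [finsum_set_coe_eq_finsum_mem (cosetsIn (A * z)) (f := fun c => F (cosetPoint c x)),
    finsum_set_coe_eq_finsum_mem (cosetsIn A) (f := fun c => F (cosetPoint c x)), himage,
    finsum_mem_image (cosetMul_injective z).injOn]
  refine finsum_mem_congr rfl fun c _ => ?_
  rw [← cosetPoint_smul_eq, hzx]

/-! ### Diagonal forms of integer matrices -/

/-- Smith normal form, without the divisibility of consecutive diagonal entries. -/
theorem exists_eq_mul_diagonal_mul {R ι : Type*} [CommRing R] [IsDomain R]
    [IsPrincipalIdealRing R] [Fintype ι] [DecidableEq ι] (E : Matrix ι ι R) (hE : E.det ≠ 0) :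
    ∃ (P Q : Matrix ι ι R) (d : ι → R), IsUnit P.det ∧ IsUnit Q.det ∧
      E = P * Matrix.diagonal d * Q := by
  have hinj : Function.Injective E.mulVecLin := by
    intro v w h
    have h0 : E.mulVec (v - w) = 0 := by
      rw [Matrix.mulVec_sub, sub_eq_zero]
      exact h
    exact sub_eq_zero.mp (Matrix.eq_zero_of_mulVec_eq_zero hE h0)
  let φ := LinearEquiv.ofInjective E.mulVecLin hinj
  obtain ⟨b, a, ab, hab⟩ := Submodule.exists_smith_normal_form_of_rank_eq (Pi.basisFun R ι)
    (N := LinearMap.range E.mulVecLin) φ.finrank_eq.symm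
  let c := ab.map φ.symm
  have hc : ∀ i, E.mulVec (c i) = a i • b i := fun i => by
    rw [← hab i, ← φ.apply_symm_apply (ab i)]
    rfl
  have hmul : E * (Pi.basisFun R ι).toMatrix c =
      (Pi.basisFun R ι).toMatrix b * Matrix.diagonal a := by
    ext r i
    have h1 : (E * (Pi.basisFun R ι).toMatrix c) r i = E.mulVec (c i) r := rfl
    rw [h1, hc, Matrix.mul_diagonal, mul_comm]
    rfl
  have hflip := fun b' : Module.Basis ι R (ι → R) =>
    (Pi.basisFun R ι).toMatrix_mul_toMatrix_flip b'
  refine ⟨(Pi.basisFun R ι).toMatrix b, c.toMatrix (Pi.basisFun R ι), a, ?_, ?_, ?_⟩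
  · exact IsUnit.of_mul_eq_one (b.toMatrix (Pi.basisFun R ι)).det
      (by rw [← Matrix.det_mul, hflip, Matrix.det_one])
  · exact IsUnit.of_mul_eq_one_right ((Pi.basisFun R ι).toMatrix c).det
      (by rw [← Matrix.det_mul, hflip, Matrix.det_one])
  · rw [← hmul, mul_assoc, hflip, mul_one]

theorem mul_diagonal_mul_eq_submatrix {R ι : Type*} [CommRing R] [Fintype ι] [DecidableEq ι]
    (P Q : Matrix ι ι R) (d : ι → R) (σ : Equiv.Perm ι) :
    P * Matrix.diagonal d * Q =
      P.submatrix id σ * Matrix.diagonal (d ∘ σ) * Q.submatrix σ id := by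
  rw [← Matrix.submatrix_diagonal_equiv, Matrix.submatrix_mul_equiv, Matrix.submatrix_mul_equiv,
    Matrix.submatrix_id_id]

/-- An integer matrix which is congruent mod `p ^ j` to a matrix of rank one, and which is diagonal
with powers of `p` up to sign on the diagonal, has at most one of these powers below `p ^ j`. -/
theorem le_or_le_of_diagonal_rank_one {ι : Type*} [DecidableEq ι] {p : ℕ} (hp : p.Prime) {j : ℕ}
    {u v e : ι → ℤ} {α : ι → ℕ} (he : ∀ k, (e k).natAbs = p ^ α k)
    (h : ∀ k l, (p : ℤ) ^ j ∣ Matrix.diagonal e k l - u k * v l) {k l : ι} (hkl : k ≠ l) :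
    j ≤ α k ∨ j ≤ α l := by
  have hpZ : Prime (p : ℤ) := Nat.prime_iff_prime_int.mp hp
  by_contra! hcon
  have key : ∀ m, α m < j → ∃ x : ℤ, u m * v m = (p : ℤ) ^ α m * x ∧ ¬ (p : ℤ) ∣ x := by
    intro m hm
    obtain ⟨y, hy⟩ := h m m
    rw [Matrix.diagonal_apply_eq] at hy
    have hs : ∃ s : ℤ, IsUnit s ∧ e m = (p : ℤ) ^ α m * s := by
      have := he m
      rcases Int.natAbs_eq (e m) with h1 | h1 <;> rw [h1, this]
      · exact ⟨1, isUnit_one, by push_cast; ring⟩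
      · exact ⟨-1, isUnit_one.neg, by push_cast; ring⟩
    obtain ⟨s, hs, hes⟩ := hs
    obtain ⟨t, rfl⟩ : ∃ t, j = α m + 1 + t := ⟨j - (α m + 1), by omega⟩
    refine ⟨s - p * (p ^ t * y), ?_, fun hd => ?_⟩
    · rw [hes] at hy
      linear_combination -hy
    · have : (p : ℤ) ∣ s := by
        have := dvd_add hd (dvd_mul_right (p : ℤ) (p ^ t * y))
        simpa using this
      exact hpZ.not_isUnit (isUnit_of_dvd_unit this hs)
  obtain ⟨x, hx, hpx⟩ := key k hcon.1
  obtain ⟨y, hy, hpy⟩ := key l hcon.2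
  have h1 : (p : ℤ) ^ j ∣ u k * v l := by
    have := h k l
    rwa [Matrix.diagonal_apply_ne _ hkl, zero_sub, dvd_neg] at this
  have h2 : (p : ℤ) ^ j ∣ u l * v k := by
    have := h l k
    rwa [Matrix.diagonal_apply_ne _ hkl.symm, zero_sub, dvd_neg] at this
  have h3 : (p : ℤ) ^ (j + j) ∣ x * y * p ^ (α k + α l) := by
    have h4 := mul_dvd_mul h1 h2
    have h5 : u k * v l * (u l * v k) = x * y * p ^ (α k + α l) := by
      linear_combination (u l * v l) * hx + (p : ℤ) ^ α k * x * hy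
    rwa [h5, ← pow_add] at h4
  have h6 : ¬ (p : ℤ) ∣ x * y := fun hd => (hpZ.dvd_or_dvd hd).elim hpx hpy
  have h7 : (p : ℤ) ^ (j + j) ∣ (p : ℤ) ^ (α k + α l) := hpZ.pow_dvd_of_dvd_mul_left _ h6 h3
  have h8 : p ^ (j + j) ∣ p ^ (α k + α l) := by exact_mod_cast h7
  have := (Nat.pow_dvd_pow_iff_le_right hp.one_lt).mp h8
  omega

/-! ### Integer matrices in double cosets of `SL_n(ℤ)` -/

theorem mem_Gam_of_eq_mapMatrix {n : ℕ} {g : GL (Fin n) ℝ} {Y : Matrix (Fin n) (Fin n) ℤ}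
    (h : g.1 = (algebraMap ℤ ℝ).mapMatrix Y) (hdet : g.1.det = 1) : g ∈ Gam n := by
  have hY : Y.det = 1 := by
    rw [h, ← RingHom.map_det] at hdet
    exact (algebraMap ℤ ℝ).injective_int (by simpa using hdet)
  exact ⟨⟨Y, hY⟩, Units.ext h.symm⟩

theorem mapGL_val {n : ℕ} (X : Matrix.SpecialLinearGroup (Fin n) ℤ) :
    (Matrix.SpecialLinearGroup.mapGL ℝ X : GL (Fin n) ℝ).1 = (algebraMap ℤ ℝ).mapMatrix X.1 := rfl

theorem mapGL_mem_Gam {n : ℕ} (X : Matrix.SpecialLinearGroup (Fin n) ℤ) :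
    (Matrix.SpecialLinearGroup.mapGL ℝ X : GL (Fin n) ℝ) ∈ Gam n := ⟨X, rfl⟩

theorem ppDiag_natCast_val {n : ℕ} (p : ℕ) [Fact p.Prime] (a : Fin n → ℕ) :
    (ppDiag p fun i => (a i : ℤ)).1 =
      (algebraMap ℤ ℝ).mapMatrix (Matrix.diagonal fun i => (p : ℤ) ^ a i) := by
  rw [RingHom.mapMatrix_apply, Matrix.diagonal_map (map_zero _)]
  change Matrix.diagonal _ = _
  congr 1
  funext i
  simp

/-- An integer matrix of positive determinant lies in `Γ diag(p^a) Γ` as soon as it is equivalent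
to `diag(p^a)` up to signs and over `GL_n(ℤ)`. -/
theorem mem_dcoset_of_eq_mul_diagonal_mul {n : ℕ} (hn : 0 < n) (p : ℕ) [hp : Fact p.Prime]
    (a : Fin n → ℕ) (P Q : Matrix (Fin n) (Fin n) ℤ) (d : Fin n → ℤ) (hP : IsUnit P.det)
    (hQ : IsUnit Q.det) (hd : ∀ k, (d k).natAbs = p ^ a k) (g : GL (Fin n) ℝ)
    (hg : g.1 = (algebraMap ℤ ℝ).mapMatrix (P * Matrix.diagonal d * Q))
    (hpos : 0 < (P * Matrix.diagonal d * Q).det) :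
    g ∈ dcoset (ppDiag p fun i => (a i : ℤ)) := by
  -- It suffices to find factors of determinant one.
  have of_det_one : ∀ P' Q' : Matrix (Fin n) (Fin n) ℤ, P'.det = 1 → Q'.det = 1 →
      P * Matrix.diagonal d * Q = P' * Matrix.diagonal (fun i => (p : ℤ) ^ a i) * Q' →
      g ∈ dcoset (ppDiag p fun i => (a i : ℤ)) := by
    intro P' Q' hP' hQ' h
    obtain ⟨X, rfl⟩ : ∃ X : Matrix.SpecialLinearGroup (Fin n) ℤ, X.1 = P' := ⟨⟨P', hP'⟩, rfl⟩
    obtain ⟨Y, rfl⟩ : ∃ Y : Matrix.SpecialLinearGroup (Fin n) ℤ, Y.1 = Q' := ⟨⟨Q', hQ'⟩, rfl⟩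
    refine DoubleCoset.mem_doubleCoset.mpr ⟨_, mapGL_mem_Gam X, _, mapGL_mem_Gam Y, Units.ext ?_⟩
    rw [Units.val_mul, Units.val_mul, mapGL_val, mapGL_val, ppDiag_natCast_val, ← map_mul,
      ← map_mul, hg, h]
  have hs : ∀ k, ∃ s : ℤ, IsUnit s ∧ d k = s * (p : ℤ) ^ a k := by
    intro k
    rcases Int.natAbs_eq (d k) with h1 | h1 <;> rw [h1, hd k]
    · exact ⟨1, isUnit_one, by push_cast; ring⟩
    · exact ⟨-1, isUnit_one.neg, by push_cast; ring⟩
  choose s hs hds using hs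
  set D : Matrix (Fin n) (Fin n) ℤ := Matrix.diagonal fun i => (p : ℤ) ^ a i with hD
  have hdiag : Matrix.diagonal d = Matrix.diagonal s * D := by
    rw [hD, Matrix.diagonal_mul_diagonal]
    congr 1
    funext k
    exact hds k
  have hDpos : 0 < D.det := by
    rw [hD, Matrix.det_diagonal]
    exact Finset.prod_pos fun i _ => pow_pos (by exact_mod_cast hp.out.pos) _
  have hPs : IsUnit (P * Matrix.diagonal s).det := by
    rw [Matrix.det_mul, Matrix.det_diagonal]
    exact hP.mul (IsUnit.prod_univ_iff.mpr hs)
  have hdet : 0 < (P * Matrix.diagonal s).det * Q.det := by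
    have h1 : (P * Matrix.diagonal d * Q).det = (P * Matrix.diagonal s).det * Q.det * D.det := by
      rw [hdiag, ← mul_assoc, Matrix.det_mul, Matrix.det_mul]
      ring
    rw [h1] at hpos
    exact pos_of_mul_pos_left hpos hDpos.le
  rcases Int.isUnit_iff.mp hPs with h1 | h1 <;> rcases Int.isUnit_iff.mp hQ with h2 | h2
  · exact of_det_one _ _ h1 h2 (by simp only [hdiag, mul_assoc])
  · rw [h1, h2] at hdet
    norm_num at hdet
  · rw [h1, h2] at hdet
    norm_num at hdet
  · -- A reflection commuting with diagonal matrices corrects both signs.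
    set J : Matrix (Fin n) (Fin n) ℤ :=
      Matrix.diagonal (Function.update (fun _ => 1) ⟨0, hn⟩ (-1)) with hJ
    have hJdet : J.det = -1 := by
      rw [hJ, Matrix.det_diagonal, Finset.prod_update_of_mem (Finset.mem_univ _)]
      simp
    have hJJ : J * J = 1 := by
      rw [hJ, Matrix.diagonal_mul_diagonal, ← Matrix.diagonal_one]
      congr 1
      funext k
      by_cases hk : k = ⟨0, hn⟩
      · subst hk; simp
      · simp [Function.update_of_ne hk]
    have hJD : J * D = D * J := by
      rw [hJ, hD, Matrix.diagonal_mul_diagonal, Matrix.diagonal_mul_diagonal]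
      congr 1
      funext k
      exact mul_comm _ _
    refine of_det_one (P * Matrix.diagonal s * J) (J * Q) ?_ ?_ ?_
    · rw [Matrix.det_mul, h1, hJdet]; norm_num
    · rw [Matrix.det_mul, h2, hJdet]; norm_num
    · calc P * Matrix.diagonal d * Q = P * Matrix.diagonal s * (D * (J * J)) * Q := by
            simp only [hdiag, hJJ, mul_one, mul_assoc]
        _ = _ := by
            rw [← mul_assoc D, ← hJD]
            simp only [mul_assoc]

/-- The smallest exponent is an invariant of the double coset. -/
theorem le_of_ppDiag_mem_dcoset {n : ℕ} (p : ℕ) [hp : Fact p.Prime] {a b : Fin n → ℕ}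
    (h : ppDiag p (fun i => (a i : ℤ)) ∈ dcoset (ppDiag p fun i => (b i : ℤ))) {m : ℕ}
    (hb : ∀ i, m ≤ b i) (i : Fin n) : m ≤ a i := by
  obtain ⟨_, ⟨X, rfl⟩, _, ⟨Y, rfl⟩, h⟩ := DoubleCoset.mem_doubleCoset.mp h
  have h1 := congrArg Units.val h
  rw [Units.val_mul, Units.val_mul, mapGL_val, mapGL_val, ppDiag_natCast_val, ppDiag_natCast_val,
    ← map_mul, ← map_mul] at h1
  have h2 := Matrix.map_injective (algebraMap ℤ ℝ).injective_int h1
  have h3 : (p : ℤ) ^ a i = ∑ r, X.1 i r * (p : ℤ) ^ b r * Y.1 r i := by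
    have := congrFun (congrFun h2 i) i
    rw [Matrix.diagonal_apply_eq, Matrix.mul_apply] at this
    simpa only [Matrix.mul_diagonal] using this
  have h4 : (p : ℤ) ^ m ∣ (p : ℤ) ^ a i := by
    rw [h3]
    exact Finset.dvd_sum fun r _ =>
      Dvd.dvd.mul_right (Dvd.dvd.mul_left (pow_dvd_pow _ (hb r)) _) _
  have h5 : p ^ m ∣ p ^ a i := by exact_mod_cast h4
  exact (Nat.pow_dvd_pow_iff_le_right hp.out.one_lt).mp h5

/-! ### The double cosets in the product -/

/-- The tuple `(a, b, …, b, c)` with natural entries. -/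
def natTuple (n a b c : ℕ) : Fin n → ℕ := fun k =>
  if (k : ℕ) = 0 then a else if (k : ℕ) + 1 = n then c else b

theorem natCast_natTuple (n a b c : ℕ) :
    (fun k => (natTuple n a b c k : ℤ)) = tuple n a b c := by
  funext k
  simp only [natTuple, tuple]
  split_ifs <;> rfl

theorem sum_natTuple {n : ℕ} (hn : 2 ≤ n) (a b c : ℕ) :
    ∑ k, natTuple n a b c k = a + (n - 2) * b + c := by
  obtain ⟨m, rfl⟩ : ∃ m, n = m + 2 := ⟨n - 2, by omega⟩
  rw [Fin.sum_univ_succ, Fin.sum_univ_castSucc]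
  have h : ∀ i : Fin m, natTuple (m + 2) a b c i.castSucc.succ = b := fun i => by
    have := i.2
    simp [natTuple, this.ne]
  simp only [h]
  simp [natTuple, add_assoc]

theorem exists_perm_eq_natTuple {n : ℕ} (hn : 2 ≤ n) {α : Fin n → ℕ} {j : ℕ}
    (hsum : ∑ k, α k = n * j) (hlow : ∀ k l, k ≠ l → j ≤ α k ∨ j ≤ α l)
    (hhigh : ∀ k l, k ≠ l → α k ≤ j ∨ α l ≤ j) :
    ∃ i ≤ j, ∃ σ : Equiv.Perm (Fin n), ∀ k, α (σ k) = natTuple n (2 * j - i) j i k := by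
  have hconst : ∑ _k : Fin n, j = n * j := by simp
  by_cases hall : ∀ k, α k = j
  · refine ⟨j, le_rfl, 1, fun k => ?_⟩
    have : 2 * j - j = j := by omega
    simp [hall, natTuple, this]
  · have hlt : ∃ k, α k < j := by
      by_contra! h
      obtain ⟨k, hk⟩ := not_forall.mp hall
      have := Finset.sum_lt_sum (fun i (_ : i ∈ Finset.univ) => h i)
        ⟨k, Finset.mem_univ k, lt_of_le_of_ne (h k) (Ne.symm hk)⟩
      omega
    have hgt : ∃ k, j < α k := by
      by_contra! h
      obtain ⟨k, hk⟩ := not_forall.mp hall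
      have := Finset.sum_lt_sum (fun i (_ : i ∈ Finset.univ) => h i)
        ⟨k, Finset.mem_univ k, lt_of_le_of_ne (h k) hk⟩
      omega
    obtain ⟨k₁, h₁⟩ := hlt
    obtain ⟨k₂, h₂⟩ := hgt
    have hne : k₂ ≠ k₁ := by rintro rfl; omega
    have hmid : ∀ k, k ≠ k₁ → k ≠ k₂ → α k = j := fun k hk1 hk2 => by
      have := hlow k k₁ hk1
      have := hhigh k k₂ hk2
      omega
    have htwo : α k₂ + α k₁ = 2 * j := by
      have h0 : ∑ k, ((α k : ℤ) - j) = 0 := by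
        rw [Finset.sum_sub_distrib]
        have : (∑ k, (α k : ℤ)) = n * j := by exact_mod_cast hsum
        rw [this]
        simp
      rw [← Finset.sum_subset (Finset.subset_univ {k₂, k₁}), Finset.sum_pair hne] at h0
      · omega
      · intro k _ hk
        simp only [Finset.mem_insert, Finset.mem_singleton, not_or] at hk
        rw [hmid k hk.2 hk.1, sub_self]
    let z : Fin n := ⟨0, by omega⟩
    let w : Fin n := ⟨n - 1, by omega⟩
    have hzw : z ≠ w := by
      intro h
      have : 0 = n - 1 := congrArg Fin.val h
      omega
    set l := Equiv.swap z k₂ k₁ with hl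
    have hlz : l ≠ z := by
      intro h
      rw [hl, Equiv.swap_apply_eq_iff, Equiv.swap_apply_left] at h
      exact hne h.symm
    set σ : Equiv.Perm (Fin n) := Equiv.swap z k₂ * Equiv.swap w l with hσ
    have hσz : σ z = k₂ := by
      rw [hσ, Equiv.Perm.mul_apply, Equiv.swap_apply_of_ne_of_ne hzw hlz.symm,
        Equiv.swap_apply_left]
    have hσw : σ w = k₁ := by
      rw [hσ, Equiv.Perm.mul_apply, Equiv.swap_apply_left, hl, Equiv.swap_apply_self]
    refine ⟨α k₁, h₁.le, σ, fun k => ?_⟩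
    unfold natTuple
    split_ifs with hk0 hkn
    · rw [show k = z from Fin.ext hk0, hσz]
      omega
    · rw [show k = w from Fin.ext (by change (k : ℕ) = n - 1; omega), hσw]
    · refine hmid _ ?_ ?_
      · rw [← hσw, Ne, σ.injective.eq_iff]
        rintro rfl
        change n - 1 + 1 ≠ n at hkn
        omega
      · rw [← hσz, Ne, σ.injective.eq_iff]
        rintro rfl
        exact hk0 rfl

theorem dvd_mul_diagonal_mul_sub {ι : Type*} [Fintype ι] [DecidableEq ι] {m : ℤ} {b : ι → ℤ}
    {r₀ : ι} (h0 : b r₀ = 1) (hb : ∀ r ≠ r₀, m ∣ b r) (X Z : Matrix ι ι ℤ) (k l : ι) :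
    m ∣ (X * Matrix.diagonal b * Z) k l - X k r₀ * Z r₀ l := by
  rw [Matrix.mul_apply]
  simp only [Matrix.mul_diagonal]
  rw [← Finset.add_sum_erase _ _ (Finset.mem_univ r₀), h0, mul_one, add_sub_cancel_left]
  exact Finset.dvd_sum fun r hr =>
    Dvd.dvd.mul_right (Dvd.dvd.mul_left (hb r (Finset.ne_of_mem_erase hr)) _) _

/-- The elementary divisors of `diag(p^j, …, p^j, 1) Y diag(p^j, 1, …, 1)`, for `Y ∈ SL_n(ℤ)`. Both
this matrix and `p^(2j)` times its inverse are of rank one mod `p^j`, so that at most one exponent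
is below `j` and at most one above `j`. -/
theorem exists_mem_dcoset_natTuple {n : ℕ} (hn : 2 ≤ n) (p : ℕ) [hp : Fact p.Prime] (j : ℕ)
    (Y : Matrix.SpecialLinearGroup (Fin n) ℤ) :
    ∃ i ≤ j, ppDiag p (fun k => (natTuple n j j 0 k : ℤ)) * Matrix.SpecialLinearGroup.mapGL ℝ Y *
        ppDiag p (fun k => (natTuple n j 0 0 k : ℤ)) ∈
      dcoset (ppDiag p fun k => (natTuple n (2 * j - i) j i k : ℤ)) := by
  have hp0 : (0 : ℤ) < p := by exact_mod_cast hp.out.pos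
  set a := natTuple n j 0 0 with ha
  set b := natTuple n j j 0 with hb
  let z : Fin n := ⟨0, by omega⟩
  let w : Fin n := ⟨n - 1, by omega⟩
  have haz : a z = j := by simp [ha, natTuple, z]
  have haz' : ∀ k ≠ z, a k = 0 := fun k hk => by
    have : (k : ℕ) ≠ 0 := fun h => hk (Fin.ext h)
    simp [ha, natTuple, this]
  have hbw : b w = 0 := by
    have h1 : n - 1 ≠ 0 := by omega
    have h2 : n - 1 + 1 = n := by omega
    simp [hb, natTuple, w, h1, h2]
  have hbw' : ∀ k ≠ w, b k = j := fun k hk => by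
    have : (k : ℕ) + 1 ≠ n := fun h => hk (Fin.ext (by change (k : ℕ) = n - 1; omega))
    simp [hb, natTuple, this]
  set A : Matrix (Fin n) (Fin n) ℤ := Matrix.diagonal fun k => (p : ℤ) ^ a k with hA
  set B : Matrix (Fin n) (Fin n) ℤ := Matrix.diagonal fun k => (p : ℤ) ^ b k with hB
  set A' : Matrix (Fin n) (Fin n) ℤ := Matrix.diagonal fun k => (p : ℤ) ^ (j - a k) with hA'
  set B' : Matrix (Fin n) (Fin n) ℤ := Matrix.diagonal fun k => (p : ℤ) ^ (j - b k) with hB'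
  have hcompl : ∀ f : Fin n → ℕ, (∀ k, f k ≤ j) →
      (Matrix.diagonal fun k => (p : ℤ) ^ (j - f k)) * (Matrix.diagonal fun k => (p : ℤ) ^ f k) =
        (p : ℤ) ^ j • 1 := by
    intro f hf
    rw [Matrix.diagonal_mul_diagonal, ← Matrix.diagonal_one, ← Matrix.diagonal_smul]
    congr 1
    funext k
    simp [← pow_add, Nat.sub_add_cancel (hf k)]
  have hAA : A' * A = (p : ℤ) ^ j • 1 := hcompl a fun k => by
    by_cases hk : k = z
    · rw [hk, haz]
    · rw [haz' k hk]; omega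
  have hBB : B' * B = (p : ℤ) ^ j • 1 := hcompl b fun k => by
    by_cases hk : k = w
    · rw [hk, hbw]; omega
    · rw [hbw' k hk]
  set E := B * Y.1 * A with hE
  set E' := A' * (Y⁻¹).1 * B' with hE'
  have hEE : E' * E = ((p : ℤ) ^ (2 * j)) • 1 := by
    have hYY : (Y⁻¹).1 * Y.1 = 1 := by
      rw [← Matrix.SpecialLinearGroup.coe_mul, inv_mul_cancel, Matrix.SpecialLinearGroup.coe_one]
    calc E' * E = A' * (Y⁻¹).1 * (B' * B) * Y.1 * A := by
          simp only [hE, hE', mul_assoc]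
      _ = (p : ℤ) ^ j • (A' * ((Y⁻¹).1 * Y.1) * A) := by
          rw [hBB]
          simp only [Matrix.mul_smul, Matrix.smul_mul, mul_one, mul_assoc]
      _ = _ := by
          rw [hYY, mul_one, hAA, smul_smul, ← pow_add, two_mul]
  have hdetE : E.det = (p : ℤ) ^ (n * j) := by
    rw [hE, Matrix.det_mul, Matrix.det_mul, Y.2, mul_one, hA, hB, Matrix.det_diagonal,
      Matrix.det_diagonal, Finset.prod_pow_eq_pow_sum, Finset.prod_pow_eq_pow_sum, ← pow_add,
      ha, hb, sum_natTuple hn, sum_natTuple hn]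
    obtain ⟨m, rfl⟩ : ∃ m, n = m + 2 := ⟨n - 2, by omega⟩
    congr 1
    simp
    ring
  have hEpos : 0 < E.det := hdetE ▸ pow_pos hp0 _
  obtain ⟨P, Q, d, hP, hQ, hPQ⟩ := exists_eq_mul_diagonal_mul E hEpos.ne'
  have hPP := Matrix.nonsing_inv_mul P hP
  have hQQ := Matrix.mul_nonsing_inv Q hQ
  set D := Matrix.diagonal d with hD
  have hDE : D = P⁻¹ * E * Q⁻¹ := by
    calc D = (P⁻¹ * P) * D * (Q * Q⁻¹) := by rw [hPP, hQQ, one_mul, mul_one]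
      _ = _ := by rw [hPQ]; simp only [mul_assoc]
  set D' := Q * E' * P with hD'
  have hDD : D' * D = ((p : ℤ) ^ (2 * j)) • 1 := by
    calc D' * D = Q * E' * (P * D * Q) * Q⁻¹ := by
          simp only [hD', mul_assoc, hQQ, mul_one]
      _ = Q * (E' * E) * Q⁻¹ := by rw [← hPQ]; simp only [mul_assoc]
      _ = _ := by rw [hEE, Matrix.mul_smul, mul_one, Matrix.smul_mul, hQQ]
  have hentry : ∀ k l, D' k l * d l = if k = l then (p : ℤ) ^ (2 * j) else 0 := fun k l => by
    have := congrFun (congrFun hDD k) l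
    rw [hD, Matrix.mul_diagonal] at this
    rw [this]
    simp [Matrix.one_apply]
  have hpow : ∀ k, ∃ α β, α + β = 2 * j ∧ (d k).natAbs = p ^ α ∧ (D' k k).natAbs = p ^ β := by
    intro k
    have h1 : (D' k k).natAbs * (d k).natAbs = p ^ (2 * j) := by
      rw [← Int.natAbs_mul, hentry, if_pos rfl, Int.natAbs_pow, Int.natAbs_natCast]
    obtain ⟨β, -, hβ⟩ := (Nat.dvd_prime_pow hp.out).mp ⟨_, h1.symm⟩
    obtain ⟨α, -, hα⟩ := (Nat.dvd_prime_pow hp.out).mp ⟨_, ((mul_comm _ _).trans h1).symm⟩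
    refine ⟨α, β, ?_, hα, hβ⟩
    rw [hα, hβ, ← pow_add] at h1
    rw [add_comm]
    exact Nat.pow_right_injective hp.out.two_le h1
  choose α β hαβ hα hβ using hpow
  have hd0 : ∀ k, d k ≠ 0 := fun k h => by
    have := hα k
    rw [h] at this
    exact pow_ne_zero _ hp.out.ne_zero this.symm
  have hlow : ∀ k l, k ≠ l → j ≤ α k ∨ j ≤ α l := by
    intro k l hkl
    refine le_or_le_of_diagonal_rank_one hp.out (u := fun k => P⁻¹ k w)
      (v := fun l => (Y.1 * A * Q⁻¹) w l) hα (fun k l => ?_) hkl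
    have h1 : D = P⁻¹ * B * (Y.1 * A * Q⁻¹) := by
      rw [hDE, hE]
      simp only [mul_assoc]
    rw [← hD, h1]
    refine dvd_mul_diagonal_mul_sub ?_ (fun r hr => ?_) _ _ _ _
    · simp [hbw]
    · simp [hbw' r hr]
  have hhigh : ∀ k l, k ≠ l → j ≤ β k ∨ j ≤ β l := by
    intro k l hkl
    refine le_or_le_of_diagonal_rank_one hp.out (u := fun k => Q k z)
      (v := fun l => ((Y⁻¹).1 * B' * P) z l) hβ (fun k l => ?_) hkl
    have h1 : Matrix.diagonal (fun k => D' k k) = D' := by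
      ext k l
      by_cases h : k = l
      · subst h; simp
      · rw [Matrix.diagonal_apply_ne _ h]
        have := hentry k l
        rw [if_neg h] at this
        exact ((mul_eq_zero.mp this).resolve_right (hd0 l)).symm
    have h2 : D' = Q * A' * ((Y⁻¹).1 * B' * P) := by
      rw [hD', hE']
      simp only [mul_assoc]
    rw [h1, h2]
    refine dvd_mul_diagonal_mul_sub ?_ (fun r hr => ?_) _ _ _ _
    · simp [haz]
    · simp [haz' r hr]
  have hsum : ∑ k, α k = n * j := by
    have h1 := congrArg Int.natAbs (congrArg Matrix.det hPQ)
    rw [hdetE, hD, Matrix.det_mul, Matrix.det_mul, Int.natAbs_mul, Int.natAbs_mul,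
      Int.isUnit_iff_natAbs_eq.mp hP, Int.isUnit_iff_natAbs_eq.mp hQ, Matrix.det_diagonal,
      ← Int.natAbsHom_apply, ← Int.natAbsHom_apply, map_prod, one_mul, mul_one] at h1
    simp only [Int.natAbsHom_apply, hα, Finset.prod_pow_eq_pow_sum, Int.natAbs_pow,
      Int.natAbs_natCast] at h1
    exact (Nat.pow_right_injective hp.out.two_le h1).symm
  obtain ⟨i, hi, σ, hσ⟩ := exists_perm_eq_natTuple hn hsum hlow fun k l hkl => by
    have := hhigh k l hkl
    have := hαβ k
    have := hαβ l
    omega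
  refine ⟨i, hi, ?_⟩
  rw [hD, mul_diagonal_mul_eq_submatrix P Q d σ] at hPQ
  refine mem_dcoset_of_eq_mul_diagonal_mul (by omega) p _ (P.submatrix id σ) (Q.submatrix σ id)
    (d ∘ σ) ?_ ?_ (fun k => ?_) _ ?_ ?_
  · rw [Matrix.det_permute']
    exact (Units.isUnit _).mul hP
  · rw [Matrix.det_permute]
    exact (Units.isUnit _).mul hQ
  · rw [Function.comp_apply, hα, hσ]
  · rw [← hPQ, Units.val_mul, Units.val_mul, mapGL_val, ppDiag_natCast_val, ppDiag_natCast_val,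
      ← map_mul, ← map_mul]
  · rwa [← hPQ]

/-! ### Bounding the multiplicities -/

theorem ppDiag_conj_mem_Gam {n : ℕ} (p : ℕ) [hp : Fact p.Prime] (a : Fin n → ℕ)
    (Y : Matrix.SpecialLinearGroup (Fin n) ℤ)
    (h : ∀ m r, (p : ℤ) ^ a r ∣ (p : ℤ) ^ a m * Y.1 m r) :
    ppDiag p (fun k => (a k : ℤ)) * Matrix.SpecialLinearGroup.mapGL ℝ Y *
      (ppDiag p fun k => (a k : ℤ))⁻¹ ∈ Gam n := by
  choose Z hZ using h
  have hmul : Matrix.of Z * (Matrix.diagonal fun k => (p : ℤ) ^ a k) =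
      (Matrix.diagonal fun k => (p : ℤ) ^ a k) * Y.1 := by
    ext m r
    rw [Matrix.mul_diagonal, Matrix.diagonal_mul, hZ, Matrix.of_apply, mul_comm]
  refine mem_Gam_of_eq_mapMatrix (Y := Matrix.of Z) ?_ ?_
  · rw [Units.val_mul, Units.mul_inv_eq_iff_eq_mul, Units.val_mul, mapGL_val, ppDiag_natCast_val,
      ← map_mul, ← map_mul, hmul]
  · rw [← Matrix.GeneralLinearGroup.val_det_apply]
    simp

/-- Let `u` be a primitive integer vector such that the `z`-th coordinate of every integer vector
orthogonal to `u` is divisible by `p ^ k`. Then all coordinates of `u` but one are divisible by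
`p ^ k`, and the remaining one is a unit mod `p`. -/
theorem exists_coprime_and_forall_dvd {ι : Type*} [Fintype ι] [DecidableEq ι] {p : ℕ}
    (hp : p.Prime) {u x : ι → ℤ} (hx : x ⬝ᵥ u = 1) (z : ι) {k : ℕ}
    (h : ∀ v : ι → ℤ, v ⬝ᵥ u = 0 → (p : ℤ) ^ k ∣ v z) :
    ∃ l, IsCoprime (u l) (p : ℤ) ∧ ∀ m ≠ l, (p : ℤ) ^ k ∣ u m := by
  have hpZ : Prime (p : ℤ) := Nat.prime_iff_prime_int.mp hp
  obtain ⟨l, hl⟩ : ∃ l, ¬ (p : ℤ) ∣ u l := by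
    by_contra! hall
    refine hpZ.not_isUnit (isUnit_of_dvd_one ?_)
    rw [← hx]
    exact Finset.dvd_sum fun i _ => Dvd.dvd.mul_left (hall i) _
  refine ⟨l, ((Prime.coprime_iff_not_dvd hpZ).mpr hl).symm, fun m hm => ?_⟩
  rcases Nat.eq_zero_or_pos k with rfl | hk
  · simp
  have key : ∀ m, (p : ℤ) ^ k ∣ (u m • Pi.single l 1 - u l • Pi.single m 1 : ι → ℤ) z :=
    fun m => h _ (by
      simp only [sub_dotProduct, smul_dotProduct, single_one_dotProduct, smul_eq_mul]
      ring)
  have hlz : z = l := by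
    by_contra hne
    have := key z
    simp only [Pi.sub_apply, Pi.smul_apply, Pi.single_eq_of_ne hne, Pi.single_eq_same, smul_eq_mul,
      mul_zero, mul_one, zero_sub, dvd_neg] at this
    exact hl ((dvd_pow_self _ hk.ne').trans this)
  have := key m
  rw [hlz] at this
  simpa [Pi.single_eq_of_ne hm.symm] using this

/-- `CosetCode p j k z c l r` says that the lattice `ℤⁿ diag(p^j, 1, …, 1) X` of the coset `c` is
the set of `v` with `v ⬝ w ≡ 0` mod `p ^ j`, for a vector `w` with `l`-th coordinate `1` and other
coordinates `p ^ k * r m`. Here `w` is obtained by scaling the first column of `X⁻¹`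
(its column of index `z`). -/
def CosetCode {n : ℕ} (p : ℕ) [Fact p.Prime] (j k : ℕ) (z : Fin n) (c : Cosets n) (l : Fin n)
    (r : {m // m ≠ l} → ℕ) : Prop :=
  ∃ (X : Matrix.SpecialLinearGroup (Fin n) ℤ) (t : ℤ),
    coset (ppDiag p (fun m => (natTuple n j 0 0 m : ℤ)) * Matrix.SpecialLinearGroup.mapGL ℝ X) = c ∧
    (p : ℤ) ^ j ∣ t * (X⁻¹).1 l z - 1 ∧
    ∀ m : {m // m ≠ l}, (p : ℤ) ^ j ∣ t * (X⁻¹).1 m z - p ^ k * r m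

/-- A coset is determined by its lattice, hence by its code: the codes of `X` and `X'` agree only if
`diag(p^j, 1, …, 1)` conjugates `X' X⁻¹` into `Γ`. -/
theorem CosetCode.eq {n : ℕ} {p : ℕ} [hp : Fact p.Prime] {j k : ℕ} {z : Fin n} (hz : (z : ℕ) = 0)
    {c c' : Cosets n} {l : Fin n} {r : {m // m ≠ l} → ℕ} (h : CosetCode p j k z c l r)
    (h' : CosetCode p j k z c' l r) : c = c' := by
  obtain ⟨X, t, rfl, hl, hr⟩ := h
  obtain ⟨X', t', rfl, hl', hr'⟩ := h'
  have hw : ∀ m, (p : ℤ) ^ j ∣ t * (X⁻¹).1 m z - t' * (X'⁻¹).1 m z := by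
    intro m
    by_cases hm : m = l
    · subst hm
      have := dvd_sub hl hl'
      rwa [sub_sub_sub_cancel_right] at this
    · have := dvd_sub (hr ⟨m, hm⟩) (hr' ⟨m, hm⟩)
      rwa [sub_sub_sub_cancel_right] at this
  have hcol : ∀ m ≠ z, (p : ℤ) ^ j ∣ (X' * X⁻¹).1 m z := by
    intro m hm
    have h1 : (p : ℤ) ^ j ∣ t * (X' * X⁻¹).1 m z - t' * (X' * X'⁻¹).1 m z := by
      rw [Matrix.SpecialLinearGroup.coe_mul, Matrix.SpecialLinearGroup.coe_mul, Matrix.mul_apply,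
        Matrix.mul_apply, Finset.mul_sum, Finset.mul_sum, ← Finset.sum_sub_distrib]
      refine Finset.dvd_sum fun s _ => ?_
      have := (hw s).mul_left (X'.1 m s)
      convert this using 1
      ring
    rw [mul_inv_cancel, Matrix.SpecialLinearGroup.coe_one, Matrix.one_apply_ne hm, mul_zero,
      sub_zero] at h1
    -- `t` is invertible mod `p ^ j`, with inverse the `l`-th coordinate of the column of `X⁻¹`.
    have h2 := dvd_sub (h1.mul_left ((X⁻¹).1 l z)) (hl.mul_right ((X' * X⁻¹).1 m z))
    have h3 : ∀ a b : ℤ, a * (t * b) - (t * a - 1) * b = b := fun a b => by ring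
    rwa [h3] at h2
  rw [coset_eq_coset_iff]
  have := ppDiag_conj_mem_Gam p (natTuple n j 0 0) (X' * X⁻¹) (fun m s => by
    by_cases hs : s = z
    · subst hs
      by_cases hm : m = s
      · subst hm
        exact dvd_mul_right _ _
      · have : natTuple n j 0 0 s = j := by simp [natTuple, hz]
        rw [this]
        exact (hcol m hm).mul_left _
    · have h0 : (s : ℕ) ≠ 0 := fun h => hs (Fin.ext (h.trans hz.symm))
      have : natTuple n j 0 0 s = 0 := by simp [natTuple, h0]
      rw [this, pow_zero]
      exact one_dvd _)
  simpa [mul_assoc] using this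

/-- For `ℤⁿ M` to contribute to the multiplicity of `Γ E`, `E = diag(p^(2j-i), p^j, …, p^j, p^i)`,
it has to lie in `p⁻ʲ ℤⁿ E`, which forces `p^(j-i)` to divide the first coordinate of all its vectors.
Hence the linear form defining `ℤⁿ M` in `ℤⁿ` is, mod `p^(j-i)`, a multiple of one coordinate. -/
theorem exists_cosetCode {n : ℕ} (p : ℕ) [hp : Fact p.Prime] {i j : ℕ} (hij : i ≤ j)
    {z : Fin n} (hz : (z : ℕ) = 0) {c : Cosets n}
    (hc : c ∈ factorSet (ppDiag p fun m => (natTuple n j 0 0 m : ℤ))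
      (ppDiag p fun m => (natTuple n j j 0 m : ℤ))
      (ppDiag p fun m => (natTuple n (2 * j - i) j i m : ℤ))) :
    ∃ (l : Fin n) (r : {m // m ≠ l} → Fin (p ^ i)),
      CosetCode p j (j - i) z c l fun m => r m := by
  obtain ⟨M, rfl, hM, hE⟩ := hc
  obtain ⟨g, hg, _, ⟨X, rfl⟩, rfl⟩ := DoubleCoset.mem_doubleCoset.mp hM
  obtain ⟨g', hg', h, hh, hEq⟩ := DoubleCoset.mem_doubleCoset.mp hE
  have hp0 : (p : ℤ) ≠ 0 := by exact_mod_cast hp.out.ne_zero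
  set A : Matrix (Fin n) (Fin n) ℤ := Matrix.diagonal fun k => (p : ℤ) ^ natTuple n j 0 0 k with hA
  -- The first column of `A X` is divisible by `p ^ (j - i)`, as `p ^ j A X E⁻¹` is integral.
  have hcol : ∀ r, (p : ℤ) ^ (j - i) ∣ (A * X.1) r z := by
    obtain ⟨H, hH⟩ := (Gam n).mul_mem hh hg
    obtain ⟨K, hK⟩ := (Gam n).inv_mem hg'
    have h1 : ppDiag p (fun m => (natTuple n j j 0 m : ℤ)) * Matrix.SpecialLinearGroup.mapGL ℝ H *
        (ppDiag p (fun m => (natTuple n j 0 0 m : ℤ)) * Matrix.SpecialLinearGroup.mapGL ℝ X) =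
        Matrix.SpecialLinearGroup.mapGL ℝ K *
          ppDiag p fun m => (natTuple n (2 * j - i) j i m : ℤ) := by
      rw [mul_inv_eq_iff_eq_mul] at hEq
      rw [hH, hK, hEq]
      simp only [mul_assoc, inv_mul_cancel_left]
    have h2 := congrArg Units.val h1
    simp only [Units.val_mul, mapGL_val, ppDiag_natCast_val, ← map_mul] at h2
    have h3 := Matrix.map_injective (algebraMap ℤ ℝ).injective_int h2
    rw [← hA] at h3
    set B' : Matrix (Fin n) (Fin n) ℤ :=
      Matrix.diagonal fun k => (p : ℤ) ^ (j - natTuple n j j 0 k) with hB'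
    have hBB : B' * (Matrix.diagonal fun k => (p : ℤ) ^ natTuple n j j 0 k) = (p : ℤ) ^ j • 1 := by
      rw [hB', Matrix.diagonal_mul_diagonal, ← Matrix.diagonal_one, ← Matrix.diagonal_smul]
      congr 1
      funext k
      have : natTuple n j j 0 k ≤ j := by
        unfold natTuple
        split_ifs <;> omega
      simp [← pow_add, Nat.sub_add_cancel this]
    have hHH : (H⁻¹).1 * H.1 = 1 := by
      rw [← Matrix.SpecialLinearGroup.coe_mul, inv_mul_cancel, Matrix.SpecialLinearGroup.coe_one]
    have h4 : (p : ℤ) ^ j • (A * X.1) = (H⁻¹).1 * B' * K.1 *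
        Matrix.diagonal fun k => (p : ℤ) ^ natTuple n (2 * j - i) j i k := by
      calc (p : ℤ) ^ j • (A * X.1) = (H⁻¹).1 * ((p : ℤ) ^ j • 1) * H.1 * (A * X.1) := by
            rw [Matrix.mul_smul, mul_one, Matrix.smul_mul, hHH, Matrix.smul_mul, one_mul]
        _ = _ := by
            rw [← hBB, mul_assoc _ K.1, ← h3]
            simp only [mul_assoc]
    intro r
    have h5 := congrFun (congrFun h4 r) z
    rw [Matrix.mul_diagonal, Matrix.smul_apply, smul_eq_mul,
      show natTuple n (2 * j - i) j i z = j + (j - i) by simp [natTuple, hz]; omega, pow_add] at h5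
    refine ⟨((H⁻¹).1 * B' * K.1) r z, mul_left_cancel₀ (pow_ne_zero j hp0) ?_⟩
    linear_combination h5
  set u : Fin n → ℤ := fun m => (X⁻¹).1 m z with hu
  have hXX : (X⁻¹).1 * X.1 = 1 := by
    rw [← Matrix.SpecialLinearGroup.coe_mul, inv_mul_cancel, Matrix.SpecialLinearGroup.coe_one]
  have hprim : X.1 z ⬝ᵥ u = 1 := by
    have h1 : (X.1 * (X⁻¹).1) z z = 1 := by
      rw [← Matrix.SpecialLinearGroup.coe_mul, mul_inv_cancel, Matrix.SpecialLinearGroup.coe_one,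
        Matrix.one_apply_eq]
    exact h1
  have hlat : ∀ v : Fin n → ℤ, v ⬝ᵥ u = 0 → (p : ℤ) ^ (j - i) ∣ v z := by
    intro v hv
    -- The coordinate vector `y = v X⁻¹` vanishes at `z`, hence `v = y X = (y A) X`.
    set y := Matrix.vecMul v (X⁻¹).1 with hy
    have hyz : y z = 0 := hv
    have hyA : Matrix.vecMul y A = y := by
      funext m
      rw [hA, Matrix.vecMul_diagonal]
      by_cases hm : m = z
      · rw [hm, hyz, zero_mul]
      · have h0 : (m : ℕ) ≠ 0 := fun h => hm (Fin.ext (h.trans hz.symm))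
        simp [natTuple, h0]
    have hv' : v = Matrix.vecMul y (A * X.1) := by
      rw [← Matrix.vecMul_vecMul, hyA, hy, Matrix.vecMul_vecMul, hXX, Matrix.vecMul_one]
    rw [hv']
    change _ ∣ ∑ r, y r * (A * X.1) r z
    exact Finset.dvd_sum fun r _ => Dvd.dvd.mul_left (hcol r) (y r)
  obtain ⟨l, hl, hdvd⟩ := exists_coprime_and_forall_dvd hp.out hprim z hlat
  obtain ⟨t, s, hts⟩ := hl.pow_right (n := j)
  choose q hq using fun m : {m // m ≠ l} => hdvd m m.2
  have hpi : (0 : ℤ) < (p : ℤ) ^ i := pow_pos (by exact_mod_cast hp.out.pos) _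
  have hmod : ∀ m, ((((t * q m) % (p : ℤ) ^ i).toNat : ℕ) : ℤ) = (t * q m) % (p : ℤ) ^ i :=
    fun m => Int.toNat_of_nonneg (Int.emod_nonneg _ hpi.ne')
  refine ⟨l, fun m => ⟨((t * q m) % (p : ℤ) ^ i).toNat, ?_⟩, X, t, ?_, ?_, fun m => ?_⟩
  · have := Int.emod_lt_of_pos (t * q m) hpi
    rw [← hmod] at this
    exact_mod_cast this
  · rw [coset_eq_coset_iff]
    simpa [mul_assoc] using hg
  · exact ⟨-s, by linear_combination hts⟩
  · change (p : ℤ) ^ j ∣ t * u m - p ^ (j - i) * ((((t * q m) % (p : ℤ) ^ i).toNat : ℕ) : ℤ)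
    rw [hmod, hq]
    obtain ⟨w, hw⟩ := Int.dvd_self_sub_emod (x := t * q m) (m := (p : ℤ) ^ i)
    refine ⟨w, ?_⟩
    have hpow : (p : ℤ) ^ j = p ^ (j - i) * p ^ i := by rw [← pow_add, Nat.sub_add_cancel hij]
    rw [hpow]
    linear_combination (p : ℤ) ^ (j - i) * hw

/-- A contributing coset is determined by its code, and there are `n (p^i)^(n-1)` codes. -/
theorem ncard_factorSet_le {n : ℕ} (hn : 0 < n) (p : ℕ) [hp : Fact p.Prime] {i j : ℕ}
    (hij : i ≤ j) :
    (factorSet (ppDiag p fun m => (natTuple n j 0 0 m : ℤ))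
      (ppDiag p fun m => (natTuple n j j 0 m : ℤ))
      (ppDiag p fun m => (natTuple n (2 * j - i) j i m : ℤ))).ncard ≤ n * p ^ ((n - 1) * i) := by
  set S := factorSet (ppDiag p fun m => (natTuple n j 0 0 m : ℤ))
    (ppDiag p fun m => (natTuple n j j 0 m : ℤ))
    (ppDiag p fun m => (natTuple n (2 * j - i) j i m : ℤ))
  have hz : ((⟨0, hn⟩ : Fin n) : ℕ) = 0 := rfl
  choose l r hlr using fun c : S => exists_cosetCode p hij hz c.2
  let f : S → Σ l : Fin n, ({m // m ≠ l} → Fin (p ^ i)) := fun c => ⟨l c, r c⟩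
  have hf : Function.Injective f := by
    intro c c' h
    have hc : ∀ c, CosetCode p j (j - i) ⟨0, hn⟩ c.1 (f c).1 fun m => (f c).2 m := hlr
    have h' := hc c
    rw [h] at h'
    exact Subtype.ext (h'.eq hz (hc c'))
  have hcard := Nat.card_le_card_of_injective f hf
  rw [← Nat.card_coe_set_eq]
  refine hcard.trans_eq ?_
  rw [Nat.card_eq_fintype_card, Fintype.card_sigma]
  simp [← pow_mul, mul_comm]

/-! ### The product of `T_{[j]}` and `T'_{[j]}` -/

theorem disjoint_dcoset_natTuple {n : ℕ} (hn : 2 ≤ n) (p : ℕ) [hp : Fact p.Prime] {j i k : ℕ}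
    (hi : i ≤ j) (hk : k ≤ j) (hik : i ≠ k) :
    Disjoint (dcoset (ppDiag p fun m => (natTuple n (2 * j - i) j i m : ℤ)))
      (dcoset (ppDiag p fun m => (natTuple n (2 * j - k) j k m : ℤ))) := by
  by_contra h
  have heq := DoubleCoset.eq_of_not_disjoint h
  have hlast : ∀ a b c, natTuple n a b c ⟨n - 1, by omega⟩ = c := fun a b c => by
    have h1 : n - 1 ≠ 0 := by omega
    have h2 : n - 1 + 1 = n := by omega
    simp [natTuple, h1, h2]
  have hmin : ∀ l ≤ j, ∀ m, l ≤ natTuple n (2 * j - l) j l m := fun l hl m => by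
    unfold natTuple
    split_ifs <;> omega
  have h1 := le_of_ppDiag_mem_dcoset p (heq ▸ DoubleCoset.mem_doubleCoset_self (Gam n) (Gam n) _)
    (hmin k hk) ⟨n - 1, by omega⟩
  have h2 := le_of_ppDiag_mem_dcoset p
    (heq.symm ▸ DoubleCoset.mem_doubleCoset_self (Gam n) (Gam n) _) (hmin i hi) ⟨n - 1, by omega⟩
  rw [hlast] at h1 h2
  omega

theorem ppDiag_add_const {n : ℕ} (p : ℕ) [hp : Fact p.Prime] (a : Fin n → ℤ) (s : ℤ) :
    ppDiag p (fun k => a k + s) = ppDiag p a * ppDiag p fun _ => s := by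
  have hp0 : (p : ℝ) ≠ 0 := Nat.cast_ne_zero.mpr hp.out.ne_zero
  refine Units.ext ?_
  change Matrix.diagonal _ = Matrix.diagonal _ * Matrix.diagonal _
  rw [Matrix.diagonal_mul_diagonal]
  congr 1
  funext k
  exact zpow_add₀ hp0 _ _

theorem ppDiag_const_mem_center {n : ℕ} (p : ℕ) [hp : Fact p.Prime] (s : ℤ) :
    ppDiag p (fun _ : Fin n => s) ∈ Subgroup.center (GL (Fin n) ℝ) := by
  refine Subgroup.mem_center_iff.mpr fun g => Units.ext ?_
  change g.1 * Matrix.diagonal _ = Matrix.diagonal _ * g.1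
  ext i k
  rw [Matrix.mul_diagonal, Matrix.diagonal_mul, mul_comm]

theorem T_add_const {n : ℕ} (p : ℕ) [Fact p.Prime] (a : Fin n → ℤ) (s : ℤ) :
    T p (fun k => a k + s) = T p a := by
  ext1 F
  change heckeFun (ppDiag p fun k => a k + s) F = heckeFun (ppDiag p a) F
  rw [ppDiag_add_const, heckeFun_mul_central _ (ppDiag_const_mem_center p s)]

theorem T_tuple_add_const {n : ℕ} (p : ℕ) [Fact p.Prime] (a b c s : ℤ) :
    T p (tuple n (a + s) (b + s) (c + s)) = T p (tuple n a b c) := by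
  rw [← T_add_const p (tuple n a b c) s]
  congr 1
  funext k
  simp only [tuple]
  split_ifs <;> rfl

/-- The product of the two operators, with the multiplicities still given as cardinalities. -/
theorem Tj_mul_Tj' {n : ℕ} (hn : 2 ≤ n) (p : ℕ) [hp : Fact p.Prime] (j : ℕ) :
    Tj n p j * Tj' n p j = ∑ i ∈ Finset.range (j + 1),
      ((factorSet (ppDiag p fun m => (natTuple n j 0 0 m : ℤ))
        (ppDiag p fun m => (natTuple n j j 0 m : ℤ))
        (ppDiag p fun m => (natTuple n (2 * j - i) j i m : ℤ))).ncard : ℂ) •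
      T p fun m => (natTuple n (2 * j - i) j i m : ℤ) := by
  have hTj : Tj n p j = T p fun m => (natTuple n j 0 0 m : ℤ) := by
    rw [natCast_natTuple]; rfl
  have hTj' : Tj' n p j = T p fun m => (natTuple n j j 0 m : ℤ) := by
    rw [natCast_natTuple]; rfl
  rw [hTj, hTj']
  ext F y
  rw [LinearMap.sum_apply, Finset.sum_apply]
  refine heckeFun_heckeFun (finite_cosetsIn p _) (finite_cosetsIn p _) (Finset.range (j + 1))
    (fun i => ppDiag p fun m => (natTuple n (2 * j - i) j i m : ℤ)) (fun i => finite_cosetsIn p _)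
    ?_ ?_ F y
  · intro M hM N hN
    obtain ⟨a, ha, b, hb, rfl⟩ := DoubleCoset.mem_doubleCoset.mp hM
    obtain ⟨a', ha', b', hb', rfl⟩ := DoubleCoset.mem_doubleCoset.mp hN
    obtain ⟨Y, hY⟩ := (Gam n).mul_mem hb' ha
    obtain ⟨i, hi, h⟩ := exists_mem_dcoset_natTuple hn p j Y
    refine ⟨i, Finset.mem_range.mpr (by omega), ?_⟩
    have := mul_mem_dcoset ha' h hb
    rw [hY] at this
    simpa only [mul_assoc] using this
  · intro i hi k hk hik
    exact disjoint_dcoset_natTuple hn p (Nat.lt_succ_iff.mp (Finset.mem_range.mp hi))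
      (Nat.lt_succ_iff.mp (Finset.mem_range.mp hk)) hik

end GLHecke

theorem lemma4 (n : ℕ) (hn : 2 ≤ n) :
    ∃ C : ℝ, ∀ (p : ℕ) [Fact p.Prime] (j : ℕ), 1 ≤ j → j ≤ n →
      ∃ c : ℕ → ℝ, (∀ i ≤ j, |c i| ≤ C) ∧
        GLHecke.Tj n p j * GLHecke.Tj' n p j =
          ∑ i ∈ Finset.range (j + 1),
            ((c i : ℂ) * (p : ℂ) ^ ((n - 1) * i)) •
              GLHecke.T p (GLHecke.tuple n (2 * (j : ℤ) - i) j i) ∧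
        GLHecke.Tj n p j * GLHecke.Tj' n p j =
          ∑ i ∈ Finset.range (j + 1),
            ((c i : ℂ) * (p : ℂ) ^ ((n - 1) * i)) •
              GLHecke.T p (GLHecke.tuple n (2 * (j : ℤ) - 2 * i) (j - i) 0) := by
  refine ⟨n, fun p hp j _ _ => ?_⟩
  have hp0 : (p : ℂ) ≠ 0 := Nat.cast_ne_zero.mpr hp.out.ne_zero
  -- The multiplicity of the `i`-th double coset in the product.
  set μ : ℕ → ℕ := fun i =>
    (GLHecke.factorSet (GLHecke.ppDiag p fun m => (GLHecke.natTuple n j 0 0 m : ℤ))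
      (GLHecke.ppDiag p fun m => (GLHecke.natTuple n j j 0 m : ℤ))
      (GLHecke.ppDiag p fun m => (GLHecke.natTuple n (2 * j - i) j i m : ℤ))).ncard with hμ
  have hprod : GLHecke.Tj n p j * GLHecke.Tj' n p j =
      ∑ i ∈ Finset.range (j + 1),
        (((μ i / (p : ℝ) ^ ((n - 1) * i) : ℝ) : ℂ) * (p : ℂ) ^ ((n - 1) * i)) •
          GLHecke.T p (GLHecke.tuple n (2 * (j : ℤ) - i) j i) := by
    rw [GLHecke.Tj_mul_Tj' hn]
    refine Finset.sum_congr rfl fun i hi => ?_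
    have hij : i ≤ 2 * j := by
      have := Finset.mem_range.mp hi
      omega
    congr 1
    · push_cast
      rw [div_mul_cancel₀ _ (pow_ne_zero _ hp0)]
    · rw [GLHecke.natCast_natTuple, Nat.cast_sub hij]
      push_cast
      rfl
  refine ⟨fun i => μ i / (p : ℝ) ^ ((n - 1) * i), fun i hi => ?_, hprod, ?_⟩
  · have hpos : (0 : ℝ) < (p : ℝ) ^ ((n - 1) * i) := pow_pos (Nat.cast_pos.mpr hp.out.pos) _
    rw [abs_of_nonneg (by positivity), div_le_iff₀ hpos]
    exact_mod_cast GLHecke.ncard_factorSet_le (by omega) p hi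
  · rw [hprod]
    refine Finset.sum_congr rfl fun i _ => ?_
    congr 1
    rw [← GLHecke.T_tuple_add_const p (2 * (j : ℤ) - 2 * i) (j - i) 0 i]
    congr 2 <;> ring
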